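/- Let $n\ge 2$ and $m=n-1$. Let $X_1,\dots,X_n$ be independent, identically distributed real random variables with finite variance $\sigma^2>0$. For random variables $V_1,\dots,V_m$ with order statistics $V_{(1)}\le\dots\le V_{(m)}$, put $V_{(0)}=0$, $V_{(n)}=1$, $W_i=V_{(i)}-V_{(i-1)}$ for $1\le i\le n$, and $S_n(W)=\sum_{i=1}^n W_iX_i$. For $\theta>0$ let $\mathcal C_\theta$ be the set of all $S_n(W)$ for which $V_1,\dots,V_m$ are independent, have the power distribution with parameter $\theta$ (density $\theta x^{\theta-1}$ on $(0,1)$), and are jointly independent of $(X_1,\dots,X_n)$; let $\mathcal C=\bigcup_{\theta>0}\mathcal C_\theta$. Suppose that the underlying probability space carries independent random variables $U_1,\dots,U_m$, uniformly distributed on $[0,1]$ and jointly independent of $(X_1,\dots,X_n)$, and let $S_n(R)$ be the average whose weights $R_i$ are the spacings of $U_1,\dots,U_m$. Then $S_n(R)\in\mathcal C_1\subset\mathcal C$, and $S_n(R)$ does not have minimum variance in $\mathcal C$: there is $S\in\mathcal C$ with $\operatorname{Var}(S)<\operatorname{Var}(S_n(R))$. Moreover, for every $\theta>0$ the set $\mathcal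 C_\theta$ is non-empty and all its members have finite second moment and the same variance $v(\theta)$; the function $v$ is differentiable at $\theta=1$ with $$v'(1)=\sigma^2\,\frac{2m-2(m+2)\sum_{i=2}^{m+1}\frac1i}{(m+1)(m+2)^2},$$ and this is negative. -/

import Mathlib

open MeasureTheory ProbabilityTheory

noncomputable section

/-- The power distribution with parameter `θ`: density `θ x ^ (θ - 1)` on `(0, 1)`
(a probability measure for `θ > 0`, with distribution function `x ^ θ` on `[0, 1]`). -/
def powerDistribution (θ : ℝ) : Measure ℝ :=
  (volume.restrict (Set.Ioo (0 : ℝ) 1)).withDensity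
    (fun x => ENNReal.ofReal (θ * x ^ (θ - 1)))

/-- The order statistics `v_(1) ≤ ... ≤ v_(m)` of the numbers `v 0, ..., v (m - 1)`. -/
def orderStatistic {m : ℕ} (v : Fin m → ℝ) (i : Fin m) : ℝ :=
  v (Tuple.sort v i)

/-- The sequence `0, v_(1), ..., v_(m), 1` that cuts `[0, 1]`. -/
def cutPoints {m : ℕ} (v : Fin m → ℝ) : Fin (m + 2) → ℝ :=
  Fin.cons (α := fun _ => ℝ) 0 (Fin.snoc (α := fun _ => ℝ) (orderStatistic v) 1)

/-- The `m + 1` spacings of the cut points. -/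
def spacing {m : ℕ} (v : Fin m → ℝ) (i : Fin (m + 1)) : ℝ :=
  cutPoints v i.succ - cutPoints v i.castSucc

/-- The randomly weighted average of `X 0, ..., X m` whose weights are the spacings of the
order statistics of `V 0, ..., V (m - 1)`. -/
def weightedAverage {Ω : Type*} {m : ℕ} (X : Fin (m + 1) → Ω → ℝ) (V : Fin m → Ω → ℝ) :
    Ω → ℝ :=
  fun ω => ∑ i, spacing (fun j => V j ω) i * X i ω

/-- `V 0, ..., V (m - 1)` is a random sample from the law `ν`, independent of the family `X`. -/
structure IsIndepSample {Ω : Type*} [MeasurableSpace Ω] {m : ℕ} (P : Measure Ω)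
    (X : Fin (m + 1) → Ω → ℝ) (ν : Measure ℝ) (V : Fin m → Ω → ℝ) : Prop where
  hasLaw : ∀ j, HasLaw (V j) ν P
  iIndep : iIndepFun V P
  indep : IndepFun (fun ω i => X i ω) (fun ω j => V j ω) P

/-- The randomly weighted averages of `X` with weights from a power distribution with
parameter `θ`. -/
def powerAverages {Ω : Type*} [MeasurableSpace Ω] {m : ℕ} (P : Measure Ω)
    (X : Fin (m + 1) → Ω → ℝ) (θ : ℝ) : Set (Ω → ℝ) :=
  {S | ∃ V : Fin m → Ω → ℝ,
    IsIndepSample P X (powerDistribution θ) V ∧ S = weightedAverage X V}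

/-- The class of all randomly weighted averages of `X` with weights from some power
distribution. -/
def powerClass {Ω : Type*} [MeasurableSpace Ω] {m : ℕ} (P : Measure Ω)
    (X : Fin (m + 1) → Ω → ℝ) : Set (Ω → ℝ) :=
  {S | ∃ θ : ℝ, 0 < θ ∧ S ∈ powerAverages P X θ}

end

/-! The spacings sum to 1, so the averages can be centred. Independence of weights and data then
removes the cross terms and leaves variance σ² E ∑ W_i² (`memLp_and_variance_weightedAverage`). The
sum ∑ W_i² is the probability that two uniform points s, t fall in the same cell, that is, that no
V_j separates them (`sum_sq_spacing_eq_integral`). By Fubini its mean is the integral of (1 - |t^θ -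
s^θ|)^m over the unit square, namely `meanSqSpacing` (`integral_sum_sq_spacing`). Differentiating
under the integral at θ = 1 and symmetrising gives 2 ∫ x log x ((1 - x)^m - x^m) dx, whose closed
form is a harmonic sum (`hasDerivAt_meanSqSpacing_one`). It is negative, so some θ > 1 beats the
uniform weights; the required sample is U_j^(1/θ), on the same probability space. -/

/-! ### Cut points and spacings: order, total, measurability. -/

theorem cutPoints_zero {m : ℕ} (v : Fin m → ℝ) : cutPoints v 0 = 0 := rfl

theorem cutPoints_last {m : ℕ} (v : Fin m → ℝ) : cutPoints v (Fin.last (m + 1)) = 1 := by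
  rw [← Fin.succ_last]
  simp only [cutPoints, Fin.cons_succ, Fin.snoc_last]

theorem cutPoints_interior {m : ℕ} (v : Fin m → ℝ) (i : Fin m) :
    cutPoints v i.castSucc.succ = orderStatistic v i := by
  simp only [cutPoints, Fin.cons_succ, Fin.snoc_castSucc]

theorem orderStatistic_monotone {m : ℕ} (v : Fin m → ℝ) : Monotone (orderStatistic v) :=
  Tuple.monotone_sort v

theorem cutPoints_monotone {m : ℕ} {v : Fin m → ℝ} (hv : ∀ j, v j ∈ Set.Icc (0 : ℝ) 1) :
    Monotone (cutPoints v) := by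
  have h0 : ∀ i, orderStatistic v i ∈ Set.Icc (0 : ℝ) 1 := fun i => hv _
  intro a b hab
  induction a using Fin.cases with
  | zero =>
    rw [cutPoints_zero]
    induction b using Fin.cases with
    | zero => exact (cutPoints_zero v).ge
    | succ b =>
      induction b using Fin.lastCases with
      | last => rw [Fin.succ_last, cutPoints_last]; norm_num
      | cast b => rw [cutPoints_interior]; exact (h0 b).1
  | succ a =>
    induction b using Fin.cases with
    | zero => exact absurd hab (by simp)
    | succ b =>
      induction b using Fin.lastCases with
      | last =>
        rw [Fin.succ_last, cutPoints_last]
        induction a using Fin.lastCases with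
        | last => rw [Fin.succ_last, cutPoints_last]
        | cast a => rw [cutPoints_interior]; exact (h0 a).2
      | cast b =>
        induction a using Fin.lastCases with
        | last =>
          rw [Fin.succ_le_succ_iff] at hab
          exact absurd hab (by simp)
        | cast a =>
          rw [cutPoints_interior, cutPoints_interior]
          exact orderStatistic_monotone v (by simpa using hab)

theorem spacing_nonneg {m : ℕ} {v : Fin m → ℝ} (hv : ∀ j, v j ∈ Set.Icc (0 : ℝ) 1)
    (i : Fin (m + 1)) : 0 ≤ spacing v i :=
  sub_nonneg.2 (cutPoints_monotone hv (Fin.castSucc_lt_succ).le)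

theorem sum_spacing {m : ℕ} (v : Fin m → ℝ) : ∑ i, spacing v i = 1 := by
  have h1 := Fin.sum_univ_succ (cutPoints v)
  have h2 := Fin.sum_univ_castSucc (cutPoints v)
  rw [cutPoints_zero] at h1
  rw [cutPoints_last] at h2
  simp only [spacing, Finset.sum_sub_distrib]
  linarith

theorem spacing_le_one {m : ℕ} {v : Fin m → ℝ} (hv : ∀ j, v j ∈ Set.Icc (0 : ℝ) 1)
    (i : Fin (m + 1)) : spacing v i ≤ 1 :=
  (Finset.single_le_sum (fun j _ => spacing_nonneg hv j) (Finset.mem_univ i)).trans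
    (sum_spacing v).le

/-- There are finitely many permutations, and each fibre is cut out by finitely many comparisons of
coordinates, with ties broken by index. -/
theorem measurable_sort (m : ℕ) : @Measurable _ _ _ ⊤ (fun v : Fin m → ℝ => Tuple.sort v) := by
  refine @measurable_to_countable' _ _ ⊤ _ _ _ fun σ => ?_
  have : (fun v : Fin m → ℝ => Tuple.sort v) ⁻¹' {σ} =
      ⋂ i : Fin m, ⋂ j : Fin m,
        {v | i ≤ j → v (σ i) ≤ v (σ j)} ∩ {v | i < j → v (σ i) = v (σ j) → σ i < σ j} := by
    ext v
    simp only [Set.mem_preimage, Set.mem_singleton_iff, Set.mem_iInter, Set.mem_inter_iff,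
      Set.mem_ofPred_eq]
    rw [eq_comm, Tuple.eq_sort_iff]
    constructor
    · exact fun h i j => ⟨fun hij => h.1 hij, fun hij => h.2 i j hij⟩
    · exact fun h => ⟨fun i j hij => (h i j).1 hij, fun i j hij => (h i j).2 hij⟩
  rw [this]
  refine MeasurableSet.iInter fun i => MeasurableSet.iInter fun j => ?_
  refine MeasurableSet.inter ?_ ?_
  · by_cases h : i ≤ j
    · simpa [h] using measurableSet_le (measurable_pi_apply (σ i)) (measurable_pi_apply (σ j))
    · simp [h]
  · by_cases h : i < j
    · by_cases h' : σ i < σ j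
      · simp [h']
      · simp only [h, h', forall_const, imp_false]
        exact (measurableSet_eq_fun (measurable_pi_apply (σ i)) (measurable_pi_apply (σ j))).compl
    · simp [h]

theorem measurable_orderStatistic {m : ℕ} (i : Fin m) :
    Measurable (fun v : Fin m → ℝ => orderStatistic v i) := by
  let _ : MeasurableSpace (Equiv.Perm (Fin m)) := ⊤
  have h : Measurable (fun p : Equiv.Perm (Fin m) × (Fin m → ℝ) => p.2 (p.1 i)) :=
    measurable_from_prod_countable_right fun σ => measurable_pi_apply (σ i)
  exact h.comp ((measurable_sort m).prodMk measurable_id)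

theorem measurable_cutPoints {m : ℕ} (i : Fin (m + 2)) :
    Measurable (fun v : Fin m → ℝ => cutPoints v i) := by
  induction i using Fin.cases with
  | zero => simp only [cutPoints_zero]; exact measurable_const
  | succ i =>
    induction i using Fin.lastCases with
    | last => simp only [Fin.succ_last, cutPoints_last]; exact measurable_const
    | cast i => simp only [cutPoints_interior]; exact measurable_orderStatistic i

theorem measurable_spacing {m : ℕ} (i : Fin (m + 1)) :
    Measurable (fun v : Fin m → ℝ => spacing v i) :=
  (measurable_cutPoints _).sub (measurable_cutPoints _)

/-! ### Squared spacings as a non-separation probability. -/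

theorem exists_mem_Ico_cutPoints {m : ℕ} (v : Fin m → ℝ) {s : ℝ} (hs : s ∈ Set.Ico (0 : ℝ) 1) :
    ∃ i : Fin (m + 1), s ∈ Set.Ico (cutPoints v i.castSucc) (cutPoints v i.succ) := by
  by_contra! h
  have : ∀ i, cutPoints v i ≤ s := by
    intro i
    induction i using Fin.induction with
    | zero => exact hs.1
    | succ i ih => exact not_lt.1 fun hlt => h i ⟨ih, hlt⟩
  have := this (Fin.last _)
  rw [cutPoints_last] at this
  exact absurd hs.2 this.not_gt

theorem eq_of_mem_Ico_cutPoints {m : ℕ} {v : Fin m → ℝ} (hv : ∀ j, v j ∈ Set.Icc (0 : ℝ) 1)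
    {s : ℝ} {i j : Fin (m + 1)}
    (hi : s ∈ Set.Ico (cutPoints v i.castSucc) (cutPoints v i.succ))
    (hj : s ∈ Set.Ico (cutPoints v j.castSucc) (cutPoints v j.succ)) : i = j := by
  have key : ∀ {i j : Fin (m + 1)},
      s ∈ Set.Ico (cutPoints v i.castSucc) (cutPoints v i.succ) →
      s ∈ Set.Ico (cutPoints v j.castSucc) (cutPoints v j.succ) → ¬ i < j := by
    intro i j hi hj hij
    have : cutPoints v i.succ ≤ cutPoints v j.castSucc :=
      by
      refine cutPoints_monotone hv ?_
      have := Fin.lt_def.1 hij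
      rw [Fin.le_def, Fin.val_succ, Fin.val_castSucc]
      omega
    linarith [hi.2, hj.1]
  exact le_antisymm (not_lt.1 (key hj hi)) (not_lt.1 (key hi hj))

/-- A point of `[s, 1)` lies in the same cell as `s` iff no sample point separates them. -/
theorem mem_Ico_cutPoints_iff {m : ℕ} {v : Fin m → ℝ} (hv : ∀ j, v j ∈ Set.Icc (0 : ℝ) 1)
    {s t : ℝ} (ht : t < 1) (hst : s ≤ t) {i : Fin (m + 1)}
    (hi : s ∈ Set.Ico (cutPoints v i.castSucc) (cutPoints v i.succ)) :
    t ∈ Set.Ico (cutPoints v i.castSucc) (cutPoints v i.succ) ↔ ∀ j, v j ∉ Set.Ioc s t := by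
  constructor
  · intro hti j hj
    have hjc : v j = cutPoints v ((Tuple.sort v).symm j).castSucc.succ := by
      rw [cutPoints_interior]; simp [orderStatistic]
    have hmono := cutPoints_monotone hv
    rw [hjc] at hj
    -- A sample point in (s, t] would be a cut point with index strictly between i and i + 1.
    have h1 : i.castSucc < ((Tuple.sort v).symm j).castSucc.succ :=
      hmono.reflect_lt (hi.1.trans_lt hj.1)
    have h2 : ((Tuple.sort v).symm j).castSucc.succ < i.succ :=
      hmono.reflect_lt (hj.2.trans_lt hti.2)
    simp only [Fin.lt_def, Fin.val_castSucc, Fin.val_succ] at h1 h2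
    omega
  · intro h
    refine ⟨hi.1.trans hst, ?_⟩
    induction i using Fin.lastCases with
    | last => rwa [Fin.succ_last, cutPoints_last]
    | cast i =>
      have hi2 := hi.2
      rw [cutPoints_interior] at hi2 ⊢
      exact not_le.1 fun hle => h (Tuple.sort v i) ⟨hi2, hle⟩

/-- The half-open cells partition [0, 1), tied sample points only producing empty cells. Only the
cell of s contributes, and it contributes 1 exactly when it also holds t. -/
theorem sum_indicator_cells {m : ℕ} {v : Fin m → ℝ} (hv : ∀ j, v j ∈ Set.Icc (0 : ℝ) 1)
    {s t : ℝ} (hs : s ∈ Set.Ico (0 : ℝ) 1) (ht : t ∈ Set.Ico (0 : ℝ) 1) :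
    ∑ i : Fin (m + 1),
      (Set.Ico (cutPoints v i.castSucc) (cutPoints v i.succ)).indicator (1 : ℝ → ℝ) s *
        (Set.Ico (cutPoints v i.castSucc) (cutPoints v i.succ)).indicator (1 : ℝ → ℝ) t =
      {w : Fin m → ℝ | ∀ j, w j ∉ Set.Ioc (min s t) (max s t)}.indicator
        (1 : (Fin m → ℝ) → ℝ) v := by
  wlog hst : s ≤ t generalizing s t
  · rw [min_comm, max_comm, ← this ht hs (not_le.1 hst).le]
    exact Finset.sum_congr rfl fun i _ => mul_comm _ _
  rw [min_eq_left hst, max_eq_right hst]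
  obtain ⟨i, hi⟩ := exists_mem_Ico_cutPoints v hs
  rw [Finset.sum_eq_single i]
  · rw [Set.indicator_of_mem hi]
    have := mem_Ico_cutPoints_iff hv ht.2 hst hi
    by_cases h : ∀ j, v j ∉ Set.Ioc s t
    · rw [Set.indicator_of_mem (this.2 h), Set.indicator_of_mem (by exact h)]; simp
    · rw [Set.indicator_of_notMem (mt this.1 h), Set.indicator_of_notMem (by exact h)]; simp
  · intro j _ hji
    rw [Set.indicator_of_notMem fun h => hji (eq_of_mem_Ico_cutPoints hv h hi), zero_mul]
  · simp

/-- The sum of the squared spacings is the probability that two uniform points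
are not separated by the sample. -/
theorem sum_sq_spacing_eq_integral {m : ℕ} {v : Fin m → ℝ}
    (hv : ∀ j, v j ∈ Set.Icc (0 : ℝ) 1) :
    ∑ i, spacing v i ^ 2 =
      ∫ p : ℝ × ℝ, {w : Fin m → ℝ | ∀ j, w j ∉ Set.Ioc (min p.1 p.2) (max p.1 p.2)}.indicator
        (1 : (Fin m → ℝ) → ℝ) v
        ∂((volume.restrict (Set.Ico (0 : ℝ) 1)).prod (volume.restrict (Set.Ico (0 : ℝ) 1))) := by
  have hmem : ∀ᵐ p : ℝ × ℝ ∂((volume.restrict (Set.Ico (0 : ℝ) 1)).prod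
      (volume.restrict (Set.Ico (0 : ℝ) 1))), p ∈ Set.Ico (0 : ℝ) 1 ×ˢ Set.Ico (0 : ℝ) 1 := by
    rw [Measure.prod_restrict]
    exact ae_restrict_mem (measurableSet_Ico.prod measurableSet_Ico)
  have hint : ∀ i : Fin (m + 1), Integrable
      ((Set.Ico (cutPoints v i.castSucc) (cutPoints v i.succ)).indicator (1 : ℝ → ℝ))
      (volume.restrict (Set.Ico (0 : ℝ) 1)) := fun i =>
    (integrable_const (1 : ℝ)).indicator measurableSet_Ico
  rw [← integral_congr_ae (hmem.mono fun p hp => sum_indicator_cells hv hp.1 hp.2),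
    integral_finsetSum _ fun i _ => (hint i).mul_prod (hint i)]
  refine Finset.sum_congr rfl fun i _ => ?_
  rw [integral_prod_mul, integral_indicator_one measurableSet_Ico, ← sq,
    measureReal_restrict_apply measurableSet_Ico, Set.inter_eq_left.2]
  · rw [Real.volume_real_Ico_of_le (sub_nonneg.1 (spacing_nonneg hv i))]
    rfl
  · refine Set.Ico_subset_Ico ?_ ?_
    · exact (cutPoints_zero v).ge.trans (cutPoints_monotone hv (Fin.zero_le _))
    · exact (cutPoints_monotone hv (Fin.le_last _)).trans (cutPoints_last v).le

/-! ### The power distribution. -/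

theorem powerDistribution_one :
    powerDistribution 1 = volume.restrict (Set.Icc (0 : ℝ) 1) := by
  rw [powerDistribution, ← restrict_Ioo_eq_restrict_Icc]
  simp

/-- Inverse transform sampling: change variables along x ↦ x^θ, the distribution function, whose
derivative is the density. -/
theorem powerDistribution_eq_map {θ : ℝ} (hθ : 0 < θ) :
    powerDistribution θ =
      (volume.restrict (Set.Icc (0 : ℝ) 1)).map (fun y => y ^ θ⁻¹) := by
  ext A hA
  have hmeas : Measurable fun y : ℝ => y ^ θ⁻¹ := by fun_prop
  rw [Measure.map_apply hmeas hA, ← restrict_Ioo_eq_restrict_Icc,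
    Measure.restrict_apply (hmeas hA), powerDistribution, withDensity_apply _ hA,
    Measure.restrict_restrict hA]
  have himg : (fun y : ℝ => y ^ θ⁻¹) ⁻¹' A ∩ Set.Ioo 0 1 =
      (fun x : ℝ => x ^ θ) '' (A ∩ Set.Ioo 0 1) := by
    ext y
    simp only [Set.mem_inter_iff, Set.mem_preimage, Set.mem_image, Set.mem_Ioo]
    constructor
    · rintro ⟨hy, h0, h1⟩
      exact ⟨y ^ θ⁻¹, ⟨hy, Real.rpow_pos_of_pos h0 _,
        Real.rpow_lt_one h0.le h1 (inv_pos.2 hθ)⟩, Real.rpow_inv_rpow h0.le hθ.ne'⟩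
    · rintro ⟨x, ⟨hx, h0, h1⟩, rfl⟩
      refine ⟨?_, Real.rpow_pos_of_pos h0 _, Real.rpow_lt_one h0.le h1 hθ⟩
      rwa [Real.rpow_rpow_inv h0.le hθ.ne']
  have hinj : Set.InjOn (fun x : ℝ => x ^ θ) (A ∩ Set.Ioo 0 1) := fun x hx y hy h =>
    (Real.rpow_left_inj hx.2.1.le hy.2.1.le hθ.ne').1 h
  have hcv := lintegral_image_eq_lintegral_abs_deriv_mul (hA.inter measurableSet_Ioo)
    (fun x hx => (Real.hasDerivAt_rpow_const (p := θ) (Or.inl hx.2.1.ne')).hasDerivWithinAt)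
    hinj (fun _ => 1)
  rw [himg, ← setLIntegral_one, hcv]
  refine setLIntegral_congr_fun (hA.inter measurableSet_Ioo) fun x hx => ?_
  rw [mul_one, abs_of_nonneg (mul_nonneg hθ.le (Real.rpow_nonneg hx.2.1.le _))]

theorem isProbabilityMeasure_powerDistribution {θ : ℝ} (hθ : 0 < θ) :
    IsProbabilityMeasure (powerDistribution θ) := by
  rw [powerDistribution_eq_map hθ]
  have : IsProbabilityMeasure (volume.restrict (Set.Icc (0 : ℝ) 1)) := ⟨by simp⟩
  exact Measure.isProbabilityMeasure_map (by fun_prop)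

theorem ae_mem_powerDistribution (θ : ℝ) :
    ∀ᵐ x ∂(powerDistribution θ), x ∈ Set.Icc (0 : ℝ) 1 :=
  (withDensity_absolutelyContinuous _ _).ae_le
    ((ae_restrict_mem measurableSet_Ioo).mono fun _ h => Set.Ioo_subset_Icc_self h)

theorem powerDistribution_real_Ioc {θ a b : ℝ} (hθ : 0 < θ) (ha : 0 ≤ a) (hab : a ≤ b)
    (hb : b ≤ 1) : (powerDistribution θ).real (Set.Ioc a b) = b ^ θ - a ^ θ := by
  have hmeas : Measurable fun y : ℝ => y ^ θ⁻¹ := by fun_prop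
  have hb0 := ha.trans hab
  rw [powerDistribution_eq_map hθ, map_measureReal_apply hmeas measurableSet_Ioc,
    measureReal_restrict_apply (hmeas measurableSet_Ioc)]
  have : (fun y : ℝ => y ^ θ⁻¹) ⁻¹' Set.Ioc a b ∩ Set.Icc 0 1 = Set.Ioc (a ^ θ) (b ^ θ) := by
    ext y
    simp only [Set.mem_inter_iff, Set.mem_preimage, Set.mem_Ioc, Set.mem_Icc]
    constructor
    · rintro ⟨⟨h1, h2⟩, h3, h4⟩
      exact ⟨(Real.lt_rpow_inv_iff_of_pos ha h3 hθ).1 h1,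
        (Real.rpow_inv_le_iff_of_pos h3 hb0 hθ).1 h2⟩
    · rintro ⟨h1, h2⟩
      have h3 : 0 ≤ y := (Real.rpow_nonneg ha _).trans h1.le
      exact ⟨⟨(Real.lt_rpow_inv_iff_of_pos ha h3 hθ).2 h1,
        (Real.rpow_inv_le_iff_of_pos h3 hb0 hθ).2 h2⟩, h3,
        h2.trans (Real.rpow_le_one hb0 hb hθ.le)⟩
  rw [this, Real.volume_real_Ioc_of_le (Real.rpow_le_rpow ha hab hθ.le)]

/-! ### Differentiation under the integral sign at θ = 1. -/

/-- The expected sum of squared spacings of `m` independent variables with the power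
distribution, as an integral over the unit square. -/
noncomputable def meanSqSpacing (m : ℕ) (θ : ℝ) : ℝ :=
  ∫ p : ℝ × ℝ, (1 - (max p.1 p.2 ^ θ - min p.1 p.2 ^ θ)) ^ m
    ∂((volume.restrict (Set.Ioo (0 : ℝ) 1)).prod (volume.restrict (Set.Ioo (0 : ℝ) 1)))

theorem ae_mem_unitSquare :
    ∀ᵐ p : ℝ × ℝ ∂((volume.restrict (Set.Ioo (0 : ℝ) 1)).prod
      (volume.restrict (Set.Ioo (0 : ℝ) 1))), p ∈ Set.Ioo (0 : ℝ) 1 ×ˢ Set.Ioo (0 : ℝ) 1 := by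
  rw [Measure.prod_restrict]
  exact ae_restrict_mem (measurableSet_Ioo.prod measurableSet_Ioo)

theorem abs_one_sub_rpow_sub_rpow_le_one {a b θ : ℝ} (ha : 0 ≤ a) (hab : a ≤ b) (hb : b ≤ 1)
    (hθ : 0 ≤ θ) : |1 - (b ^ θ - a ^ θ)| ≤ 1 := by
  have h1 := Real.rpow_le_rpow ha hab hθ
  have h2 := Real.rpow_le_one (ha.trans hab) hb hθ
  have h3 := Real.rpow_nonneg ha θ
  rw [abs_le]
  constructor <;> linarith

theorem abs_log_mul_rpow_le_two {a θ : ℝ} (ha : 0 < a) (ha1 : a ≤ 1) (hθ : 1 / 2 < θ) :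
    |Real.log a * a ^ θ| ≤ 2 := by
  have h := Real.abs_log_mul_self_rpow_lt a θ ha ha1 (by linarith)
  have : 1 / θ ≤ 2 := by rw [div_le_iff₀ (by linarith)]; linarith
  linarith

theorem hasDerivAt_one_sub_rpow_sub_rpow_pow {a b : ℝ} (ha : 0 < a) (hb : 0 < b) (k : ℕ)
    (θ : ℝ) :
    HasDerivAt (fun θ : ℝ => (1 - (b ^ θ - a ^ θ)) ^ (k + 1))
      ((k + 1) * (1 - (b ^ θ - a ^ θ)) ^ k * (Real.log a * a ^ θ - Real.log b * b ^ θ)) θ := by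
  have h1 := (hasDerivAt_id' θ).const_rpow ha
  have h2 := (hasDerivAt_id' θ).const_rpow hb
  refine (((h2.sub h1).const_sub 1).pow (k + 1)).congr_deriv ?_
  simp only [Nat.add_sub_cancel, Nat.cast_add, Nat.cast_one, Pi.sub_apply]
  ring

theorem hasDerivAt_meanSqSpacing (k : ℕ) :
    HasDerivAt (meanSqSpacing (k + 1))
      (∫ p : ℝ × ℝ, (k + 1) * (1 - (max p.1 p.2 - min p.1 p.2)) ^ k *
          (Real.log (min p.1 p.2) * min p.1 p.2 - Real.log (max p.1 p.2) * max p.1 p.2)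
        ∂((volume.restrict (Set.Ioo (0 : ℝ) 1)).prod (volume.restrict (Set.Ioo (0 : ℝ) 1)))) 1 := by
  have hbounds : ∀ p ∈ Set.Ioo (0 : ℝ) 1 ×ˢ Set.Ioo (0 : ℝ) 1,
      0 < min p.1 p.2 ∧ max p.1 p.2 < 1 := fun p hp =>
    ⟨lt_min hp.1.1 hp.2.1, max_lt hp.1.2 hp.2.2⟩
  have h := (hasDerivAt_integral_of_dominated_loc_of_deriv_le
    (μ := (volume.restrict (Set.Ioo (0 : ℝ) 1)).prod (volume.restrict (Set.Ioo (0 : ℝ) 1)))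
    (F := fun θ (p : ℝ × ℝ) => (1 - (max p.1 p.2 ^ θ - min p.1 p.2 ^ θ)) ^ (k + 1))
    (F' := fun θ (p : ℝ × ℝ) => (k + 1) * (1 - (max p.1 p.2 ^ θ - min p.1 p.2 ^ θ)) ^ k *
      (Real.log (min p.1 p.2) * min p.1 p.2 ^ θ - Real.log (max p.1 p.2) * max p.1 p.2 ^ θ))
    -- For θ > 1/2 each term |log a · a^θ| is at most 1/θ ≤ 2; two such terms give the constant 4.
    (x₀ := (1 : ℝ)) (s := Set.Ioi (1 / 2)) (bound := fun _ => (k + 1) * 4)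
    (Ioi_mem_nhds (by norm_num)) (Filter.Eventually.of_forall fun θ => by fun_prop)
    ?_ (by fun_prop) ?_ (integrable_const _) ?_).2
  · simp only [Real.rpow_one] at h
    exact h
  · refine Integrable.of_bound (by fun_prop) 1 (ae_mem_unitSquare.mono fun p hp => ?_)
    obtain ⟨h0, h1⟩ := hbounds p hp
    rw [norm_pow]
    exact pow_le_one₀ (norm_nonneg _)
      (abs_one_sub_rpow_sub_rpow_le_one h0.le min_le_max h1.le zero_le_one)
  · refine ae_mem_unitSquare.mono fun p hp θ hθ => ?_
    obtain ⟨h0, h1⟩ := hbounds p hp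
    rw [mul_assoc, norm_mul, norm_mul, norm_pow]
    have e1 := pow_le_one₀ (n := k) (abs_nonneg _) (abs_one_sub_rpow_sub_rpow_le_one h0.le
      min_le_max h1.le (le_of_lt (lt_trans (by norm_num) hθ) : (0 : ℝ) ≤ θ))
    have e2 := abs_log_mul_rpow_le_two h0 (min_le_max.trans h1.le) hθ
    have e3 := abs_log_mul_rpow_le_two (h0.trans_le min_le_max) h1.le hθ
    have e4 := (abs_sub _ _).trans (add_le_add e2 e3)
    have e5 : ‖(k : ℝ) + 1‖ = k + 1 := Real.norm_of_nonneg (by positivity)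
    rw [e5]
    refine mul_le_mul_of_nonneg_left ?_ (by positivity)
    calc _ ≤ 1 * (2 + 2 : ℝ) := mul_le_mul e1 e4 (abs_nonneg _) zero_le_one
      _ = 4 := by norm_num
  · refine ae_mem_unitSquare.mono fun p hp θ _ => ?_
    obtain ⟨h0, _⟩ := hbounds p hp
    exact hasDerivAt_one_sub_rpow_sub_rpow_pow h0 (h0.trans_le min_le_max) k θ

/-- The sign of `t - s`. -/
noncomputable def orderSign (s t : ℝ) : ℝ := if s < t then 1 else if t < s then -1 else 0

theorem measurable_orderSign : Measurable fun p : ℝ × ℝ => orderSign p.1 p.2 :=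
  Measurable.ite (measurableSet_lt measurable_fst measurable_snd) measurable_const
    (Measurable.ite (measurableSet_lt measurable_snd measurable_fst) measurable_const
      measurable_const)

theorem abs_orderSign_le_one (s t : ℝ) : |orderSign s t| ≤ 1 := by
  unfold orderSign
  split_ifs <;> simp

/-- Attributes each logarithmic term to its own coordinate, the sign recording whether that
coordinate is the smaller one. The two summands are swaps of each other, so they have equal
integrals and one variable can be integrated out. -/
theorem min_max_integrand_eq_add_swap (k : ℕ) (s t : ℝ) :
    (k + 1) * (1 - (max s t - min s t)) ^ k *
        (Real.log (min s t) * min s t - Real.log (max s t) * max s t) =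
      s * Real.log s * (orderSign s t * ((k + 1) * (1 - |t - s|) ^ k)) +
        t * Real.log t * (orderSign t s * ((k + 1) * (1 - |s - t|) ^ k)) := by
  rcases lt_trichotomy s t with h | rfl | h
  · rw [max_eq_right h.le, min_eq_left h.le, abs_of_pos (sub_pos.2 h), abs_of_neg (sub_neg.2 h)]
    simp only [orderSign, h, h.not_gt, if_true, if_false, neg_sub]
    ring
  · simp [orderSign]
  · rw [max_eq_left h.le, min_eq_right h.le, abs_of_pos (sub_pos.2 h), abs_of_neg (sub_neg.2 h)]
    simp only [orderSign, h, h.not_gt, if_true, if_false, neg_sub]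
    ring

/-- The function -(1 - |t - s|)^(k+1) is a continuous antiderivative away from its kink at t = s, a
countable exceptional set. -/
theorem integral_orderSign_mul_pow (k : ℕ) {s : ℝ} (hs : s ∈ Set.Ioo (0 : ℝ) 1) :
    ∫ t in Set.Ioo (0 : ℝ) 1, orderSign s t * ((k + 1) * (1 - |t - s|) ^ k) =
      (1 - s) ^ (k + 1) - s ^ (k + 1) := by
  rw [← integral_Ioc_eq_integral_Ioo, ← intervalIntegral.integral_of_le zero_le_one]
  have h := integral_eq_of_hasDerivAt_off_countable (fun t => -(1 - |t - s|) ^ (k + 1))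
    (fun t => orderSign s t * ((k + 1) * (1 - |t - s|) ^ k)) (a := 0) (b := 1)
    (Set.countable_singleton s) (by fun_prop) ?_ ?_
  · rw [h, abs_of_pos (sub_pos.2 hs.2), zero_sub, abs_neg, abs_of_pos hs.1]
    ring
  · rintro t ⟨-, hts⟩
    rcases lt_or_gt_of_ne hts with hlt | hlt
    · have e : (fun t => -(1 - |t - s|) ^ (k + 1)) =ᶠ[nhds t]
          fun t => -(1 - (s - t)) ^ (k + 1) := by
        filter_upwards [Iio_mem_nhds hlt] with y hy
        rw [abs_of_neg (sub_neg.2 hy), neg_sub]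
      refine HasDerivAt.congr_of_eventuallyEq ?_ e
      refine ((((hasDerivAt_id' t).const_sub s).const_sub 1).pow (k + 1)).neg.congr_deriv ?_
      simp only [orderSign, hlt, hlt.not_gt, if_true, if_false, abs_of_neg (sub_neg.2 hlt),
        Nat.add_sub_cancel, Nat.cast_add, Nat.cast_one]
      ring
    · have e : (fun t => -(1 - |t - s|) ^ (k + 1)) =ᶠ[nhds t]
          fun t => -(1 - (t - s)) ^ (k + 1) := by
        filter_upwards [Ioi_mem_nhds hlt] with y hy
        rw [abs_of_pos (sub_pos.2 hy)]
      refine HasDerivAt.congr_of_eventuallyEq ?_ e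
      refine ((((hasDerivAt_id' t).sub_const s).const_sub 1).pow (k + 1)).neg.congr_deriv ?_
      have hlt' : s < t := hlt
      simp only [orderSign, hlt', if_true, abs_of_pos (sub_pos.2 hlt'),
        Nat.add_sub_cancel, Nat.cast_add, Nat.cast_one]
      ring
  · have hc : IntervalIntegrable (fun t : ℝ => ((k : ℝ) + 1) * (1 - |t - s|) ^ k) volume 0 1 :=
      Continuous.intervalIntegrable (by fun_prop) _ _
    rw [intervalIntegrable_iff] at hc ⊢
    exact hc.bdd_mul (c := 1)
      (measurable_orderSign.comp (measurable_const.prodMk measurable_id)).aestronglyMeasurable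
      (Filter.Eventually.of_forall fun t => abs_orderSign_le_one s t)

theorem integral_min_max_eq (k : ℕ) :
    (∫ p : ℝ × ℝ, (k + 1) * (1 - (max p.1 p.2 - min p.1 p.2)) ^ k *
          (Real.log (min p.1 p.2) * min p.1 p.2 - Real.log (max p.1 p.2) * max p.1 p.2)
        ∂((volume.restrict (Set.Ioo (0 : ℝ) 1)).prod (volume.restrict (Set.Ioo (0 : ℝ) 1)))) =
      2 * ∫ x in (0 : ℝ)..1, x * Real.log x * ((1 - x) ^ (k + 1) - x ^ (k + 1)) := by
  set A : ℝ × ℝ → ℝ := fun p =>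
    p.1 * Real.log p.1 * (orderSign p.1 p.2 * ((k + 1) * (1 - |p.2 - p.1|) ^ k)) with hA
  have hint : Integrable A ((volume.restrict (Set.Ioo (0 : ℝ) 1)).prod
      (volume.restrict (Set.Ioo (0 : ℝ) 1))) := by
    have hm := measurable_orderSign
    refine Integrable.of_bound (by fun_prop) (1 * (1 * ((k + 1) * 1)))
      (ae_mem_unitSquare.mono fun p hp => ?_)
    have e1 : ‖p.1 * Real.log p.1‖ ≤ 1 := by
      rw [mul_comm]; exact (Real.abs_log_mul_self_lt p.1 hp.1.1 hp.1.2.le).le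
    have e2 : ‖1 - |p.2 - p.1|‖ ≤ 1 := by
      have : |p.2 - p.1| ≤ 1 := abs_le.2 ⟨by linarith [hp.1.2, hp.2.1], by linarith [hp.1.1, hp.2.2]⟩
      rw [Real.norm_eq_abs, abs_le]
      constructor <;> linarith [abs_nonneg (p.2 - p.1)]
    have e3 : ‖(k : ℝ) + 1‖ = k + 1 := Real.norm_of_nonneg (by positivity)
    rw [norm_mul, norm_mul (orderSign _ _), norm_mul ((k : ℝ) + 1), norm_pow, e3]
    have e4 := pow_le_one₀ (n := k) (norm_nonneg _) e2
    have e5 : ‖orderSign p.1 p.2‖ ≤ 1 := abs_orderSign_le_one _ _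
    gcongr
  have hswap : Integrable (fun p => A p.swap) ((volume.restrict (Set.Ioo (0 : ℝ) 1)).prod
      (volume.restrict (Set.Ioo (0 : ℝ) 1))) := hint.swap
  have hsum : ∀ p : ℝ × ℝ, (k + 1) * (1 - (max p.1 p.2 - min p.1 p.2)) ^ k *
      (Real.log (min p.1 p.2) * min p.1 p.2 - Real.log (max p.1 p.2) * max p.1 p.2) =
      A p + A p.swap := fun p => min_max_integrand_eq_add_swap k p.1 p.2
  simp_rw [hsum]
  rw [integral_add hint hswap, integral_prod_swap A, ← two_mul, integral_prod _ hint,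
    intervalIntegral.integral_of_le zero_le_one, integral_Ioc_eq_integral_Ioo]
  congr 1
  refine setIntegral_congr_fun measurableSet_Ioo fun s hs => ?_
  simp only [hA]
  rw [integral_const_mul, integral_orderSign_mul_pow k hs]

/-! ### Closed form and sign of the derivative. -/

/-- Integration by parts. The product x log x is kept together because it is continuous at 0, so the
antiderivative is continuous up to the endpoint. -/
theorem integral_pow_succ_mul_log (n : ℕ) :
    ∫ x in (0 : ℝ)..1, x * Real.log x * x ^ n = -1 / ((n : ℝ) + 2) ^ 2 := by
  have hc := Real.continuous_mul_log
  have h := intervalIntegral.integral_eq_sub_of_hasDerivAt_of_le (zero_le_one' ℝ)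
    (f := fun x => x * Real.log x * x ^ (n + 1) / (n + 2) - x ^ (n + 2) / (n + 2) ^ 2)
    (f' := fun x => x * Real.log x * x ^ n) (by fun_prop) ?_
    (Continuous.intervalIntegrable (by fun_prop) _ _)
  · rw [h]
    simp
    ring
  · intro x hx
    have h1 := (((Real.hasDerivAt_mul_log hx.1.ne').mul (hasDerivAt_pow (n + 1) x)).div_const
      ((n : ℝ) + 2)).sub ((hasDerivAt_pow (n + 2) x).div_const (((n : ℝ) + 2) ^ 2))
    refine h1.congr_deriv ?_
    have : (n : ℝ) + 2 ≠ 0 := by positivity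
    simp only [Nat.add_sub_cancel, Nat.cast_add, Nat.cast_one, Nat.cast_ofNat,
      show n + 2 - 1 = n + 1 from rfl]
    field_simp
    ring

theorem integral_mul_one_sub_pow (n : ℕ) :
    ∫ x in (0 : ℝ)..1, x * (1 - x) ^ n = 1 / (((n : ℝ) + 1) * (n + 2)) := by
  have h := intervalIntegral.integral_eq_sub_of_hasDerivAt_of_le (zero_le_one' ℝ)
    (f := fun x => (1 - x) ^ (n + 2) / (n + 2) - (1 - x) ^ (n + 1) / (n + 1))
    (f' := fun x => x * (1 - x) ^ n) (by fun_prop) ?_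
    (Continuous.intervalIntegrable (by fun_prop) _ _)
  · rw [h]
    have : (n : ℝ) + 2 ≠ 0 := by positivity
    have : (n : ℝ) + 1 ≠ 0 := by positivity
    simp
    field_simp
    ring
  · intro x _
    have h0 := (hasDerivAt_id' x).const_sub 1
    have h1 := ((h0.pow (n + 2)).div_const ((n : ℝ) + 2)).sub
      ((h0.pow (n + 1)).div_const ((n : ℝ) + 1))
    refine h1.congr_deriv ?_
    have : (n : ℝ) + 2 ≠ 0 := by positivity
    have : (n : ℝ) + 1 ≠ 0 := by positivity
    simp only [Nat.add_sub_cancel, Nat.cast_add, Nat.cast_one, Nat.cast_ofNat,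
      show n + 2 - 1 = n + 1 from rfl]
    field_simp
    ring

/-- Integrate the derivative of x² log x (1 - x)^(n+1), which vanishes at both endpoints, after
writing x² = x - x(1 - x). -/
theorem integral_mul_log_mul_one_sub_pow_succ (n : ℕ) :
    ((n : ℝ) + 3) * ∫ x in (0 : ℝ)..1, x * Real.log x * (1 - x) ^ (n + 1) =
      (n + 1) * (∫ x in (0 : ℝ)..1, x * Real.log x * (1 - x) ^ n) -
        1 / (((n : ℝ) + 2) * (n + 3)) := by
  have hc := Real.continuous_mul_log
  have i1 : IntervalIntegrable (fun x => ((n : ℝ) + 3) * (x * Real.log x * (1 - x) ^ (n + 1)))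
    volume 0 1 := Continuous.intervalIntegrable (by fun_prop) _ _
  have i2 : IntervalIntegrable (fun x => ((n : ℝ) + 1) * (x * Real.log x * (1 - x) ^ n))
    volume 0 1 := Continuous.intervalIntegrable (by fun_prop) _ _
  have i3 : IntervalIntegrable (fun x : ℝ => x * (1 - x) ^ (n + 1))
    volume 0 1 := Continuous.intervalIntegrable (by fun_prop) _ _
  have h := intervalIntegral.integral_eq_sub_of_hasDerivAt_of_le (zero_le_one' ℝ)
    (f := fun x => x * Real.log x * (x * (1 - x) ^ (n + 1)))
    (f' := fun x => ((n : ℝ) + 3) * (x * Real.log x * (1 - x) ^ (n + 1)) -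
      (n + 1) * (x * Real.log x * (1 - x) ^ n) + x * (1 - x) ^ (n + 1)) (by fun_prop) ?_
    ((i1.sub i2).add i3)
  · rw [intervalIntegral.integral_add (i1.sub i2) i3, intervalIntegral.integral_sub i1 i2,
      intervalIntegral.integral_const_mul, intervalIntegral.integral_const_mul,
      integral_mul_one_sub_pow] at h
    have e : (((n + 1 : ℕ) : ℝ) + 1) * (((n + 1 : ℕ) : ℝ) + 2) = ((n : ℝ) + 2) * (n + 3) := by
      push_cast; ring
    rw [e] at h
    simp only [Real.log_one, mul_zero, zero_mul, sub_zero] at h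
    linarith
  · intro x hx
    have h0 := (hasDerivAt_id' x).const_sub 1
    refine ((Real.hasDerivAt_mul_log hx.1.ne').mul
      ((hasDerivAt_id' x).mul (h0.pow (n + 1)))).congr_deriv ?_
    simp only [Nat.add_sub_cancel, Nat.cast_add, Nat.cast_one, Pi.mul_apply, Pi.pow_apply]
    ring

/-- By the recursion, (n + 1)(n + 2) times the integral drops by 1/(n + 3) at each step, which
builds up the harmonic sum. -/
theorem integral_mul_log_mul_one_sub_pow (n : ℕ) :
    ∫ x in (0 : ℝ)..1, x * Real.log x * (1 - x) ^ n =
      -(∑ i ∈ Finset.Icc 2 (n + 2), 1 / (i : ℝ)) / (((n : ℝ) + 1) * (n + 2)) := by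
  induction n with
  | zero =>
    have := integral_pow_succ_mul_log 0
    simp only [pow_zero] at this ⊢
    rw [this]
    norm_num
  | succ n ih =>
    have h := integral_mul_log_mul_one_sub_pow_succ n
    rw [ih] at h
    rw [show n + 1 + 2 = (n + 2) + 1 from rfl, Finset.sum_Icc_succ_top (by omega)]
    have h1 : (n : ℝ) + 1 ≠ 0 := by positivity
    have h2 : (n : ℝ) + 2 ≠ 0 := by positivity
    have h3 : (n : ℝ) + 3 ≠ 0 := by positivity
    rw [← mul_right_inj' h3, h]
    push_cast
    rw [show (n : ℝ) + 2 + 1 = n + 3 by ring, show (n : ℝ) + 1 + 1 = n + 2 by ring,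
      show (n : ℝ) + 1 + 2 = n + 3 by ring]
    field_simp
    ring

theorem hasDerivAt_meanSqSpacing_one {m : ℕ} (hm : 1 ≤ m) :
    HasDerivAt (meanSqSpacing m)
      ((2 * (m : ℝ) - 2 * ((m : ℝ) + 2) * ∑ i ∈ Finset.Icc 2 (m + 1), 1 / (i : ℝ)) /
        (((m : ℝ) + 1) * ((m : ℝ) + 2) ^ 2)) 1 := by
  obtain ⟨k, rfl⟩ := Nat.exists_eq_add_of_le' hm
  refine (hasDerivAt_meanSqSpacing k).congr_deriv ?_
  have hc := Real.continuous_mul_log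
  simp_rw [integral_min_max_eq, mul_sub]
  -- The harmonic sum arrives with top index m + 2, where m = k + 1. Its last term combines with
  -- 1/(m + 2)² to give the 2m of the numerator.
  rw [intervalIntegral.integral_sub (Continuous.intervalIntegrable (by fun_prop) _ _)
    (Continuous.intervalIntegrable (by fun_prop) _ _), integral_mul_log_mul_one_sub_pow,
    integral_pow_succ_mul_log, show k + 1 + 2 = (k + 1 + 1) + 1 from rfl,
    Finset.sum_Icc_succ_top (by omega)]
  have h2 : (k : ℝ) + 2 ≠ 0 := by positivity
  have h3 : (k : ℝ) + 3 ≠ 0 := by positivity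
  push_cast
  rw [show (k : ℝ) + 2 + 1 = k + 3 by ring, show (k : ℝ) + 1 + 1 = k + 2 by ring,
    show (k : ℝ) + 1 + 2 = k + 3 by ring, show k + 1 + 1 = k + 2 from rfl]
  field_simp
  ring

/-- Each of the m terms is at least 1/(m + 1), and (m + 2) m/(m + 1) > m. -/
theorem deriv_meanSqSpacing_one_neg {m : ℕ} (hm : 1 ≤ m) :
    (2 * (m : ℝ) - 2 * ((m : ℝ) + 2) * ∑ i ∈ Finset.Icc 2 (m + 1), 1 / (i : ℝ)) /
      (((m : ℝ) + 1) * ((m : ℝ) + 2) ^ 2) < 0 := by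
  refine div_neg_of_neg_of_pos ?_ (by positivity)
  have h : (m : ℝ) / (m + 1) ≤ ∑ i ∈ Finset.Icc 2 (m + 1), 1 / (i : ℝ) := by
    have := Finset.card_nsmul_le_sum (Finset.Icc 2 (m + 1)) (fun i : ℕ => 1 / (i : ℝ))
      (1 / ((m : ℝ) + 1)) fun i hi => by
        rw [Finset.mem_Icc] at hi
        have h0 : (0 : ℝ) < i := by exact_mod_cast (by omega : 0 < i)
        exact one_div_le_one_div_of_le h0 (by exact_mod_cast hi.2)
    simpa [div_eq_mul_inv] using this
  have hm0 : (0 : ℝ) < m := by exact_mod_cast hm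
  have h1 : (m : ℝ) < (m + 2) * (m / (m + 1)) := by
    rw [mul_div_assoc', lt_div_iff₀ (by positivity)]
    nlinarith
  have h2 := mul_le_mul_of_nonneg_left h (by positivity : (0 : ℝ) ≤ (m : ℝ) + 2)
  linarith

/-! ### Expected sum of squared spacings by Fubini. -/

theorem measurableSet_forall_notMem_Ioc (m : ℕ) :
    MeasurableSet {q : (Fin m → ℝ) × ℝ × ℝ |
      ∀ j, q.1 j ∉ Set.Ioc (min q.2.1 q.2.2) (max q.2.1 q.2.2)} := by
  have hset : {q : (Fin m → ℝ) × ℝ × ℝ |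
      ∀ j, q.1 j ∉ Set.Ioc (min q.2.1 q.2.2) (max q.2.1 q.2.2)} =
      ⋂ j, ({q | min q.2.1 q.2.2 < q.1 j} ∩ {q | q.1 j ≤ max q.2.1 q.2.2})ᶜ := by
    ext q
    simp only [Set.mem_iInter]
    rfl
  rw [hset]
  refine MeasurableSet.iInter fun j => MeasurableSet.compl (MeasurableSet.inter ?_ ?_)
  · exact measurableSet_lt (by fun_prop) (by fun_prop)
  · exact measurableSet_le (by fun_prop) (by fun_prop)

theorem ae_pi_mem_Icc {m : ℕ} {ν : Measure ℝ} [IsProbabilityMeasure ν]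
    (hν : ∀ᵐ x ∂ν, x ∈ Set.Icc (0 : ℝ) 1) :
    ∀ᵐ v ∂(Measure.pi fun _ : Fin m => ν), ∀ j, v j ∈ Set.Icc (0 : ℝ) 1 :=
  ae_all_iff.2 fun _ => Measure.tendsto_eval_ae_ae.eventually hν

/-- For fixed s, t, non-separation is a product event: every V_j avoids the interval between them,
each with probability 1 - |t^θ - s^θ|. -/
theorem integral_sum_sq_spacing (m : ℕ) {θ : ℝ} (hθ : 0 < θ) :
    ∫ v, ∑ i, spacing v i ^ 2 ∂(Measure.pi fun _ : Fin m => powerDistribution θ) =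
      meanSqSpacing m θ := by
  have := isProbabilityMeasure_powerDistribution hθ
  have hT := measurableSet_forall_notMem_Ioc m
  rw [integral_congr_ae ((ae_pi_mem_Icc (ae_mem_powerDistribution θ)).mono
    fun v hv => sum_sq_spacing_eq_integral hv), ← restrict_Ioo_eq_restrict_Ico,
    integral_integral_swap]
  · refine integral_congr_ae (ae_mem_unitSquare.mono fun p hp => ?_)
    have hset : {w : Fin m → ℝ | ∀ j, w j ∉ Set.Ioc (min p.1 p.2) (max p.1 p.2)} =
        Set.univ.pi fun _ => (Set.Ioc (min p.1 p.2) (max p.1 p.2))ᶜ := by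
      ext w; simp
    have h0 : 0 ≤ min p.1 p.2 := (lt_min hp.1.1 hp.2.1).le
    have h1 : max p.1 p.2 ≤ 1 := (max_lt hp.1.2 hp.2.2).le
    beta_reduce
    rw [hset, integral_indicator_one (MeasurableSet.univ_pi fun _ => measurableSet_Ioc.compl),
      measureReal_def, Measure.pi_pi, Finset.prod_const, Finset.card_univ, Fintype.card_fin,
      ENNReal.toReal_pow, ← measureReal_def, probReal_compl_eq_one_sub measurableSet_Ioc,
      powerDistribution_real_Ioc hθ h0 min_le_max h1]
  · exact (integrable_const (1 : ℝ)).indicator hT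

/-! ### Variance of a randomly weighted average. -/

section Variance

variable {Ω : Type*} [MeasurableSpace Ω] {P : Measure Ω} {m : ℕ}
  {X : Fin (m + 1) → Ω → ℝ} {V : Fin m → Ω → ℝ} {ν : Measure ℝ}

theorem IsIndepSample.aemeasurable (hV : IsIndepSample P X ν V) :
    AEMeasurable (fun ω j => V j ω) P :=
  aemeasurable_pi_lambda _ fun j => (hV.hasLaw j).aemeasurable

theorem IsIndepSample.map_eq_pi [IsProbabilityMeasure P] (hV : IsIndepSample P X ν V) :
    P.map (fun ω j => V j ω) = Measure.pi fun _ => ν := by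
  rw [(iIndepFun_iff_map_fun_eq_pi_map fun j => (hV.hasLaw j).aemeasurable).1 hV.iIndep]
  simp_rw [fun j => (hV.hasLaw j).map_eq]

theorem IsIndepSample.ae_mem (hV : IsIndepSample P X ν V)
    (hν : ∀ᵐ x ∂ν, x ∈ Set.Icc (0 : ℝ) 1) : ∀ᵐ ω ∂P, ∀ j, V j ω ∈ Set.Icc (0 : ℝ) 1 := by
  refine ae_all_iff.2 fun j => ae_of_ae_map (hV.hasLaw j).aemeasurable ?_
  rwa [(hV.hasLaw j).map_eq]

theorem IsIndepSample.memLp_spacing (hV : IsIndepSample P X ν V)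
    (hν : ∀ᵐ x ∂ν, x ∈ Set.Icc (0 : ℝ) 1) (i : Fin (m + 1)) :
    MemLp (fun ω => spacing (fun j => V j ω) i) ⊤ P :=
  memLp_top_of_bound
    ((measurable_spacing i).comp_aemeasurable hV.aemeasurable).aestronglyMeasurable 1
    ((hV.ae_mem hν).mono fun ω hω => by
      rw [Real.norm_of_nonneg (spacing_nonneg hω i)]
      exact spacing_le_one hω i)

theorem IsIndepSample.memLp_and_variance_weightedAverage [IsProbabilityMeasure P] (hV : IsIndepSample P X ν V)
    (hν : ∀ᵐ x ∂ν, x ∈ Set.Icc (0 : ℝ) 1) (hX_indep : iIndepFun X P)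
    (hX_ident : ∀ i, IdentDistrib (X i) (X 0) P P) (hX_sq : MemLp (X 0) 2 P) :
    MemLp (weightedAverage X V) 2 P ∧
      variance (weightedAverage X V) P =
        variance (X 0) P * ∫ v, ∑ i, spacing v i ^ 2 ∂(Measure.pi fun _ : Fin m => ν) := by
  set c := ∫ ω, X 0 ω ∂P
  set W : Fin (m + 1) → Ω → ℝ := fun i ω => spacing (fun j => V j ω) i with hW
  set Y : Fin (m + 1) → Ω → ℝ := fun i ω => X i ω - c with hY
  have hmean : ∀ i, ∫ ω, X i ω ∂P = c := fun i => (hX_ident i).integral_eq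
  have hX2 : ∀ i, MemLp (X i) 2 P := fun i => (hX_ident i).memLp_iff.2 hX_sq
  have hY2 : ∀ i, MemLp (Y i) 2 P := fun i => (hX2 i).sub (memLp_const c)
  have hXm : AEMeasurable (fun ω i => X i ω) P :=
    aemeasurable_pi_lambda _ fun i => (hX_ident i).aemeasurable_fst
  have hWtop : ∀ i, MemLp (W i) ⊤ P := hV.memLp_spacing hν
  have hWY : ∀ i, MemLp (fun ω => W i ω * Y i ω) 2 P := fun i => (hY2 i).mul (hWtop i)
  have hEY : ∀ i, ∫ ω, Y i ω ∂P = 0 := fun i => by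
    rw [hY, integral_sub ((hX2 i).integrable (by norm_num)) (integrable_const c), hmean]
    simp
  have hEYY : ∀ i j, ∫ ω, Y i ω * Y j ω ∂P = if i = j then variance (X 0) P else 0 := by
    intro i j
    split_ifs with hij
    · subst hij
      rw [← (hX_ident i).variance_eq, variance_eq_integral (hX_ident i).aemeasurable_fst, hmean]
      simp only [hY, sq]
    · have := (hX_indep.indepFun hij).covariance_eq_zero (hX2 i) (hX2 j)
      rwa [covariance, hmean, hmean] at this
  have hprod : ∀ (f : (Fin (m + 1) → ℝ) → ℝ) (h : (Fin m → ℝ) → ℝ), Measurable f →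
      Measurable h → ∫ ω, h (fun j => V j ω) * f (fun i => X i ω) ∂P =
        (∫ ω, h (fun j => V j ω) ∂P) * ∫ ω, f (fun i => X i ω) ∂P := by
    intro f h hf hh
    exact (hV.indep.symm.comp hh hf).integral_fun_mul_eq_mul_integral
      (hh.comp_aemeasurable hV.aemeasurable).aestronglyMeasurable
      (hf.comp_aemeasurable hXm).aestronglyMeasurable
  -- Centring costs only a constant because the weights sum to 1.
  have hS : weightedAverage X V = fun ω => (∑ i, W i ω * Y i ω) + c := by
    funext ω
    have h1 : ∑ i, W i ω = 1 := sum_spacing _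
    simp only [weightedAverage, hY, mul_sub, Finset.sum_sub_distrib, ← Finset.sum_mul, h1]
    ring
  have hS2 : MemLp (fun ω => ∑ i, W i ω * Y i ω) 2 P := memLp_finsetSum _ fun i _ => hWY i
  have hES : ∫ ω, ∑ i, W i ω * Y i ω ∂P = 0 := by
    rw [integral_finsetSum _ fun i _ => (hWY i).integrable (by norm_num)]
    refine Finset.sum_eq_zero fun i _ => ?_
    have := hprod (fun x => x i - c) (fun v => spacing v i) (by fun_prop) (measurable_spacing i)
    exact this.trans (by rw [show ∫ ω, X i ω - c ∂P = 0 from hEY i, mul_zero])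
  have hESS : ∫ ω, (∑ i, W i ω * Y i ω) ^ 2 ∂P =
      variance (X 0) P * ∑ i, ∫ ω, W i ω ^ 2 ∂P := by
    have hint : ∀ i j, Integrable (fun ω => W i ω * Y i ω * (W j ω * Y j ω)) P :=
      fun i j => (hWY i).integrable_mul (hWY j)
    simp_rw [sq, Finset.sum_mul_sum]
    rw [integral_finsetSum _ fun i _ => integrable_finsetSum _ fun j _ => hint i j,
      Finset.mul_sum]
    refine Finset.sum_congr rfl fun i _ => ?_
    rw [integral_finsetSum _ fun j _ => hint i j]
    -- Weights and data factor, and distinct centred X_i, X_j are uncorrelated, so only the diagonal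
    -- survives although the weights are dependent.
    have hterm : ∀ j, ∫ ω, W i ω * Y i ω * (W j ω * Y j ω) ∂P =
        (∫ ω, W i ω * W j ω ∂P) * if i = j then variance (X 0) P else 0 := by
      intro j
      rw [← hEYY i j]
      have := hprod (fun x => (x i - c) * (x j - c)) (fun v => spacing v i * spacing v j)
        (by fun_prop) ((measurable_spacing i).mul (measurable_spacing j))
      refine Eq.trans ?_ this
      exact integral_congr_ae (Filter.Eventually.of_forall fun ω => by simp only [hW, hY]; ring)
    simp_rw [hterm]
    simp [mul_comm]
  have hlaw : ∑ i, ∫ ω, W i ω ^ 2 ∂P =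
      ∫ v, ∑ i, spacing v i ^ 2 ∂(Measure.pi fun _ : Fin m => ν) := by
    have hm : Measurable fun v : Fin m → ℝ => ∑ i, spacing v i ^ 2 :=
      Finset.measurable_fun_sum _ fun i _ => (measurable_spacing i).pow_const 2
    rw [← hV.map_eq_pi, integral_map hV.aemeasurable hm.aestronglyMeasurable,
      integral_finsetSum]
    intro i _
    have := (hWtop i).mono_exponent (q := ⊤) (p := 2) le_top
    exact this.integrable_sq
  rw [hS]
  refine ⟨hS2.add (memLp_const c), ?_⟩
  rw [variance_add_const hS2.aestronglyMeasurable, variance_eq_sub hS2, hES, ← hlaw, ← hESS]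
  simp

end Variance

/-! ### Power samples from the uniform sample, and conclusion. -/

theorem IsIndepSample.rpow {Ω : Type*} [MeasurableSpace Ω] {P : Measure Ω} {m : ℕ}
    {X : Fin (m + 1) → Ω → ℝ} {U : Fin m → Ω → ℝ}
    (hU : IsIndepSample P X (volume.restrict (Set.Icc (0 : ℝ) 1)) U) {θ : ℝ} (hθ : 0 < θ) :
    IsIndepSample P X (powerDistribution θ) fun j ω => U j ω ^ θ⁻¹ where
  hasLaw j := HasLaw.comp (Y := fun y : ℝ => y ^ θ⁻¹)
    ⟨by fun_prop, (powerDistribution_eq_map hθ).symm⟩ (hU.hasLaw j)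
  iIndep := hU.iIndep.comp (fun _ y => y ^ θ⁻¹) fun _ => by fun_prop
  indep := hU.indep.comp (φ := fun x : Fin (m + 1) → ℝ => x)
    (ψ := fun (u : Fin m → ℝ) j => u j ^ θ⁻¹) measurable_id (by fun_prop)

/-- Slopes from the right are eventually negative. Choosing x to the right of a = 1 keeps the
exponent positive. -/
theorem HasDerivAt.exists_gt_lt_of_neg {f : ℝ → ℝ} {f' a : ℝ} (hf : HasDerivAt f f' a)
    (hf' : f' < 0) : ∃ x, a < x ∧ f x < f a := by
  have h := (hasDerivAt_iff_tendsto_slope.1 hf).mono_left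
    (nhdsWithin_mono a fun x (hx : x ∈ Set.Ioi a) => ne_of_gt hx)
  obtain ⟨x, hx, hax⟩ := ((h.eventually_lt_const hf').and self_mem_nhdsWithin).exists
  refine ⟨x, hax, ?_⟩
  rw [slope_def_field, div_neg_iff] at hx
  have : a < x := hax
  rcases hx with h | h <;> linarith [h.1, h.2]

theorem theorem5 {Ω : Type*} [MeasurableSpace Ω] (P : Measure Ω) [IsProbabilityMeasure P]
    (m : ℕ) (hm : 1 ≤ m)
    (X : Fin (m + 1) → Ω → ℝ)
    (hX_indep : iIndepFun X P)
    (hX_ident : ∀ i, IdentDistrib (X i) (X 0) P P)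
    (hX_sq : MemLp (X 0) 2 P)
    (hX_var : 0 < variance (X 0) P)
    (U : Fin m → Ω → ℝ)
    (hU : IsIndepSample P X (volume.restrict (Set.Icc (0 : ℝ) 1)) U) :
    weightedAverage X U ∈ powerAverages P X 1 ∧
    weightedAverage X U ∈ powerClass P X ∧
    (∃ S ∈ powerClass P X, variance S P < variance (weightedAverage X U) P) ∧
    (∃ v : ℝ → ℝ,
      (∀ θ : ℝ, 0 < θ → (powerAverages P X θ).Nonempty ∧
        ∀ S ∈ powerAverages P X θ, MemLp S 2 P ∧ variance S P = v θ) ∧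
      HasDerivAt v
        (variance (X 0) P *
          ((2 * (m : ℝ) - 2 * ((m : ℝ) + 2) * ∑ i ∈ Finset.Icc 2 (m + 1), 1 / (i : ℝ)) /
            (((m : ℝ) + 1) * ((m : ℝ) + 2) ^ 2))) 1) ∧
    (2 * (m : ℝ) - 2 * ((m : ℝ) + 2) * ∑ i ∈ Finset.Icc 2 (m + 1), 1 / (i : ℝ)) /
      (((m : ℝ) + 1) * ((m : ℝ) + 2) ^ 2) < 0 := by
  have hvar : ∀ θ : ℝ, 0 < θ → ∀ S ∈ powerAverages P X θ,
      MemLp S 2 P ∧ variance S P = variance (X 0) P * meanSqSpacing m θ := by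
    rintro θ hθ S ⟨V, hV, rfl⟩
    rw [← integral_sum_sq_spacing m hθ]
    have := isProbabilityMeasure_powerDistribution hθ
    exact hV.memLp_and_variance_weightedAverage (ae_mem_powerDistribution θ) hX_indep hX_ident
      hX_sq
  have hne : ∀ θ : ℝ, 0 < θ → (powerAverages P X θ).Nonempty := fun θ hθ =>
    ⟨_, _, hU.rpow hθ, rfl⟩
  have hU1 : weightedAverage X U ∈ powerAverages P X 1 :=
    ⟨U, by rwa [powerDistribution_one], rfl⟩
  refine ⟨hU1, ⟨1, one_pos, hU1⟩, ?_, ⟨fun θ => variance (X 0) P * meanSqSpacing m θ,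
    fun θ hθ => ⟨hne θ hθ, hvar θ hθ⟩, (hasDerivAt_meanSqSpacing_one hm).const_mul _⟩,
    deriv_meanSqSpacing_one_neg hm⟩
  obtain ⟨θ, hθ, hlt⟩ :=
    (hasDerivAt_meanSqSpacing_one hm).exists_gt_lt_of_neg (deriv_meanSqSpacing_one_neg hm)
  have hθ0 : 0 < θ := one_pos.trans hθ
  obtain ⟨S, hS⟩ := hne θ hθ0
  refine ⟨S, ⟨θ, hθ0, hS⟩, ?_⟩
  rw [(hvar θ hθ0 S hS).2, (hvar 1 one_pos _ hU1).2]
  exact mul_lt_mul_of_pos_left hlt hX_var
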